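/- **Setting.** Let $f\in C^\infty(\mathbb R^d,\mathbb R^d)$ be globally Lipschitz, $x\in\mathbb R^d$, and let $a_{ij},b_i$ ($1\le i,j\le s$) be real coefficients. One step of the stochastic Runge–Kutta method for $dX=\lambda f(X)\,dt+\sigma f(X)\circ dW$, starting at $(t,x)$ with step size $h\ge 0$, is $$H_i=x+\Delta M(h)\sum_{j=1}^s a_{ij}f(H_j)\quad(1\le i\le s),\qquad Y(t+h)=x+\Delta M(h)\sum_{i=1}^s b_i f(H_i),$$ where $\Delta M(h)$, $h\ge0$, are real random variables with $\Delta M(0)=0$: either the increments $\lambda h+\sigma\,(W(t+h)-W(t))$, with a Wiener process $W$ and real $\lambda,\sigma$, or arbitrary approximations of them. **Trees.** Let $T$ be the set of (unordered) rooted trees, consisting of the empty tree $\emptyset$ and of the trees $\tau=[\tau_1,\dots,\tau_\kappa]$, $\kappa\ge 0$, obtained by joining nonempty trees $\tau_1,\dots,\tau_\kappa$ to a common root; for $\kappa=0$ this is the one-vertex tree $\bullet$. Let $\rho(\tau)$ be the number of nodes of $\tau$. Put $F(\emptyset)(x)=x$, $F([\tau_1,\dots,\tau_\kappa])(x)=f^{(\kappa)}(x)(F(\tau_1)(x),\dots,F(\tau_\kappa)(x))$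 (so $F(\bullet)=f$), and $\alpha(\emptyset)=\alpha(\bullet)=1$, $\alpha([\tau_1,\dots,\tau_\kappa])=\frac1{r_1!\cdots r_q!}\prod_{j=1}^\kappa\alpha(\tau_j)$, where $r_1,\dots,r_q$ count equal trees among $\tau_1,\dots,\tau_\kappa$. **B-series.** For random variables $\phi(\tau)(h)$, $\tau\in T$, $h\ge0$, with $\phi(\emptyset)\equiv1$ and $\phi(\tau)(0)=0$ for $\tau\ne\emptyset$, the B-series is the formal series $$B(\phi,x;h)=\sum_{\tau\in T}\alpha(\tau)\,\phi(\tau)(h)\,F(\tau)(x).$$ Writing $Z(h)=B(\phi,x;h)$ for random vectors $Z(h)$ means: for every $N\ge0$ there are $C$ and $\delta>0$, independent of $h$ and of the realization, such that $$\Big\|Z(h)-\sum_{\rho(\tau)\le N}\alpha(\tau)\phi(\tau)(h)F(\tau)(x)\Big\|\le C\,|\Delta M(h)|^{N+1}\quad\text{whenever } |\Delta M(h)|\le\delta .$$ **Theorem.** There is $r>0$ such that the equations of the step have exactly one solution $(H_1,\dots,H_s,Y)$ for every value of $\Delta M(h)$ in $[-r,r]$. If $H_i$ and $Y(t+h)$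 satisfy these equations whenever $|\Delta M(h)|$ is at most some fixed positive number, then $$H_i=B(\Phi_i,x;h)\quad(1\le i\le s),\qquad Y(t+h)=B(\Phi,x;h),$$ with $\Phi_i(\tau)(h)=\Delta M(h)^{\rho(\tau)}\,\hat\Phi_i(\tau)$, where $$\hat\Phi_i(\emptyset)=1,\qquad \hat\Phi_i(\bullet)=\sum_{j=1}^s a_{ij},\qquad \hat\Phi_i([\tau_1,\dots,\tau_\kappa])=\sum_{j=1}^s a_{ij}\prod_{k=1}^\kappa\hat\Phi_j(\tau_k),$$ and $\Phi(\tau)(h)=\Delta M(h)^{\rho(\tau)}\,\hat\Phi(\tau)$, where $$\hat\Phi(\emptyset)=1,\qquad \hat\Phi(\bullet)=\sum_{i=1}^s b_i,\qquad \hat\Phi([\tau_1,\dots,\tau_\kappa])=\sum_{i=1}^s b_i\prod_{k=1}^\kappa\hat\Phi_i(\tau_k).$$ Moreover, let $\Delta M(h)=\lambda h+\sigma\,(W(t+h)-W(t))$ and suppose that almost surely $H_i$ and $Y(t+h)$ satisfy the equations of the step for all sufficiently small $h$ (how small may depend on the path). Then the families $\Phi_i,\Phi$ satisfy the conditions on $\phi$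 above and, almost surely, for every $N$, the expansions of $H_i$ and $Y(t+h)$ with these weights, cut after the trees with $N$ nodes, have remainders $O(|\Delta M(h)|^{N+1})$ as $h\to0$. -/

import Mathlib

open scoped NNReal Topology

namespace SRK

/-- The state space `ℝ^d` with its Euclidean norm. -/
abbrev State (d : ℕ) : Type := EuclideanSpace ℝ (Fin d)

/-! ### Symmetry of higher derivatives -/

theorem iteratedFDeriv_add_two_apply {E F : Type*} [NormedAddCommGroup E] [NormedSpace ℝ E]
    [NormedAddCommGroup F] [NormedSpace ℝ F] {f : E → F} (hf : ContDiff ℝ (⊤ : ℕ∞) f) (n : ℕ)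
    (x : E) (v : Fin (n + 2) → E) :
    iteratedFDeriv ℝ (n + 2) f x v =
      fderiv ℝ (fderiv ℝ (iteratedFDeriv ℝ n f)) x (v 0) (v 1) (fun i => v i.succ.succ) := by
  have hG : ContDiff ℝ (⊤ : ℕ∞) (iteratedFDeriv ℝ n f) :=
    hf.iteratedFDeriv_right (by exact_mod_cast le_top)
  have hG1 : ContDiff ℝ (⊤ : ℕ∞) (iteratedFDeriv ℝ (n + 1) f) :=
    hf.iteratedFDeriv_right (by exact_mod_cast le_top)
  have hG' : ContDiff ℝ (⊤ : ℕ∞) (fderiv ℝ (iteratedFDeriv ℝ n f)) :=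
    hG.fderiv_right (by exact_mod_cast le_top)
  have hd1 := ((hG1.differentiable (by simp)) x).hasFDerivAt
  have hd2 := ((hG'.differentiable (by simp)) x).hasFDerivAt
  rw [iteratedFDeriv_succ_apply_left]
  have e1 := ((ContinuousMultilinearMap.apply ℝ (fun _ : Fin (n + 1) => E) F
    (Fin.tail v)).hasFDerivAt.comp x hd1)
  have e2 := ((ContinuousMultilinearMap.apply ℝ (fun _ : Fin n => E) F
    (fun i => v i.succ.succ)).hasFDerivAt.comp x (hd2.clm_apply (hasFDerivAt_const (v 1) x)))
  have e3 := e1.unique (e2.congr_of_eventuallyEq (.of_forall fun y => by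
    simp [iteratedFDeriv_succ_apply_left]; rfl))
  have := congrArg (fun L => L (v 0)) e3
  simpa using this

/-- The higher derivatives of a smooth map are symmetric. -/
theorem iteratedFDeriv_perm {E F : Type*} [NormedAddCommGroup E] [NormedSpace ℝ E]
    [NormedAddCommGroup F] [NormedSpace ℝ F] {f : E → F} (hf : ContDiff ℝ (⊤ : ℕ∞) f) (n : ℕ) :
    ∀ (x : E) (v : Fin n → E) (e : Equiv.Perm (Fin n)),
    iteratedFDeriv ℝ n f x (v ∘ e) = iteratedFDeriv ℝ n f x v := by
  induction n with
  | zero => intro x v e; exact congrArg _ (Subsingleton.elim _ _)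
  | succ n ih =>
    intro x v e
    have he : e ∈ Submonoid.closure
        (Set.range fun i : Fin n => Equiv.swap i.castSucc i.succ) := by
      rw [Equiv.Perm.mclosure_swap_castSucc_succ]; trivial
    induction he using Submonoid.closure_induction generalizing v with
    | one => rfl
    | mul e e' _ _ h h' =>
      rw [Equiv.Perm.coe_mul, ← Function.comp_assoc, h', h]
    | mem e hmem =>
      obtain ⟨i, rfl⟩ := hmem
      cases n with
      | zero => exact i.elim0
      | succ n =>
        cases i using Fin.cases with
        | zero =>
          have hG : ContDiff ℝ (⊤ : ℕ∞) (iteratedFDeriv ℝ n f) :=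
            hf.iteratedFDeriv_right (by exact_mod_cast le_top)
          rw [iteratedFDeriv_add_two_apply hf, iteratedFDeriv_add_two_apply hf]
          have hs : IsSymmSndFDerivAt ℝ (iteratedFDeriv ℝ n f) x :=
            hG.contDiffAt.isSymmSndFDerivAt (by
              simp only [minSmoothness_of_isRCLikeNormedField]
              exact WithTop.coe_le_coe.2 (le_top : (2 : ℕ∞) ≤ ⊤))
          have h3 : (fun i : Fin n => (v ∘ Equiv.swap (0 : Fin (n + 1)).castSucc
              (Fin.succ 0)) i.succ.succ) = fun i => v i.succ.succ := by
            funext i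
            simp only [Function.comp]
            rw [Equiv.swap_apply_of_ne_of_ne] <;> simp [Fin.ext_iff]
          rw [h3, hs.eq]
          congr 3
        | succ j =>
          have hG : Differentiable ℝ (iteratedFDeriv ℝ (n + 1) f) :=
            (hf.iteratedFDeriv_right (m := (⊤ : ℕ∞)) (by exact_mod_cast le_top)).differentiable (by simp)
          have key : ∀ w : Fin (n + 1) → E, ∀ u, fderiv ℝ (iteratedFDeriv ℝ (n + 1) f) x u w =
              fderiv ℝ (fun y => iteratedFDeriv ℝ (n + 1) f y w) x u := by
            intro w u
            have e1 := ((ContinuousMultilinearMap.apply ℝ (fun _ : Fin (n + 1) => E) F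
              w).hasFDerivAt.comp x (hG x).hasFDerivAt)
            have := e1.fderiv
            exact (congrArg (fun L => L u) this).symm
          rw [iteratedFDeriv_succ_apply_left, iteratedFDeriv_succ_apply_left, key, key]
          have h0 : (v ∘ Equiv.swap j.succ.castSucc j.succ.succ) 0 = v 0 := by
            simp only [Function.comp]
            rw [Equiv.swap_apply_of_ne_of_ne] <;> simp [Fin.ext_iff]
          have ht : Fin.tail (v ∘ Equiv.swap j.succ.castSucc j.succ.succ) =
              Fin.tail v ∘ Equiv.swap j.castSucc j.succ := by
            funext k
            simp only [Fin.tail, Function.comp]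
            congr 1
            rw [← Fin.succ_castSucc]
            exact ((Fin.succ_injective _).swap_apply _ _ _)
          rw [h0, ht]
          simp_rw [ih]

/-! ### Rooted trees -/

/-- Nonempty rooted trees with ordered branches: `node κ c` joins the subtrees
`c 0, …, c (κ - 1)` each by a single branch to a common root; `node 0 _` is the tree `•`. -/
inductive PTree : Type
  | node (κ : ℕ) (c : Fin κ → PTree) : PTree

namespace PTree

/-- Two ordered trees represent the same rooted tree if they agree up to
reordering the branches at each vertex. -/
def Iso : PTree → PTree → Prop
  | node κ c, node κ' c' => ∃ e : Fin κ ≃ Fin κ', ∀ i, Iso (c i) (c' (e i))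

theorem Iso.refl (t : PTree) : Iso t t := by
  induction t with
  | node κ c ih => exact ⟨Equiv.refl _, fun i => ih i⟩

theorem Iso.symm {t u : PTree} (h : Iso t u) : Iso u t := by
  induction t generalizing u with
  | node κ c ih =>
    cases u with
    | node κ' c' =>
      obtain ⟨e, he⟩ := h
      refine ⟨e.symm, fun i => ?_⟩
      have := ih (e.symm i) (he (e.symm i))
      simpa using this

theorem Iso.trans {t u v : PTree} (h : Iso t u) (h' : Iso u v) : Iso t v := by
  induction t generalizing u v with
  | node κ c ih =>
    cases u with
    | node κ' c' =>
      cases v with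
      | node κ'' c'' =>
        obtain ⟨e, he⟩ := h
        obtain ⟨e', he'⟩ := h'
        exact ⟨e.trans e', fun i => ih i (he i) (he' (e i))⟩

instance setoid : Setoid PTree :=
  ⟨Iso, Iso.refl, fun h => Iso.symm h, fun h h' => Iso.trans h h'⟩

/-- The number of nodes. -/
def order : PTree → ℕ
  | node κ c => 1 + ∑ i : Fin κ, order (c i)

theorem order_eq_of_iso {t u : PTree} (h : Iso t u) : order t = order u := by
  induction t generalizing u with
  | node κ c ih =>
    cases u with
    | node κ' c' =>
      obtain ⟨e, he⟩ := h
      simp only [order]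
      rw [← Equiv.sum_comp e (fun i => order (c' i))]
      exact congrArg _ (Finset.sum_congr rfl fun i _ => ih i (he i))

theorem finite_order_le (N : ℕ) : {t : PTree | order t ≤ N}.Finite := by
  induction N with
  | zero =>
    refine Set.finite_empty.subset fun t ht => ?_
    cases t with
    | node κ c => simp [order] at ht
  | succ N ih =>
    have hfin : (⋃ κ : Fin (N + 1),
        (node κ.1) '' (Set.pi Set.univ fun _ : Fin κ.1 => {t : PTree | order t ≤ N})).Finite :=
      Set.finite_iUnion fun κ => (Set.Finite.pi' fun _ => ih).image _ |>.subset (by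
        apply Set.image_mono
        intro c hc i
        exact hc i (Set.mem_univ i))
    refine hfin.subset fun t ht => ?_
    cases t with
    | node κ c =>
      have hpos : ∀ t : PTree, 1 ≤ order t := fun t => by cases t; simp [order]
      have hsum : ∑ i : Fin κ, order (c i) ≤ N := by
        have : 1 + ∑ i : Fin κ, order (c i) ≤ N + 1 := ht
        omega
      have hκ : κ ≤ N := by
        calc κ = ∑ _i : Fin κ, 1 := by simp
          _ ≤ ∑ i : Fin κ, order (c i) := Finset.sum_le_sum fun i _ => hpos _
          _ ≤ N := hsum
      refine Set.mem_iUnion.2 ⟨⟨κ, by omega⟩, c, fun i _ => ?_, rfl⟩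
      exact (Finset.single_le_sum (f := fun i => order (c i)) (fun _ _ => Nat.zero_le _)
        (Finset.mem_univ i)).trans hsum

end PTree

/-- Nonempty rooted trees (without an order of the branches). -/
def RTree : Type := Quotient PTree.setoid

/-- The rooted tree represented by an ordered tree. -/
def RTree.mk (t : PTree) : RTree := Quotient.mk PTree.setoid t

open Classical in
/-- `r₁! r₂! ⋯ r_q!`, where `r₁, …, r_q` count equal trees among the rooted trees
in the multiset `m`. -/
noncomputable def multFactorial (m : Multiset RTree) : ℕ :=
  ∏ q ∈ m.toFinset, (m.count q).factorial

namespace PTree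

/-- The rooted trees among the branches at the root. -/
def branches {κ : ℕ} (c : Fin κ → PTree) : Multiset RTree :=
  Finset.univ.val.map fun i => RTree.mk (c i)

/-- `α([τ₁, …, τ_κ]) = (r₁! ⋯ r_q!)⁻¹ ∏ α(τ_j)`. -/
noncomputable def alpha : PTree → ℚ
  | node _ c => (∏ j, alpha (c j)) / (multFactorial (branches c) : ℚ)

theorem branches_eq {κ : ℕ} {c c' : Fin κ → PTree} (e : Fin κ ≃ Fin κ)
    (he : ∀ i, Iso (c i) (c' (e i))) : branches c = branches c' := by
  have h1 : branches c =
      Finset.univ.val.map (fun i => RTree.mk (c' (e i))) :=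
    Multiset.map_congr rfl fun i _ => Quotient.sound (he i)
  have h2 : Multiset.map e (Finset.univ : Finset (Fin κ)).val = Finset.univ.val := by
    simp
  have h3 := Multiset.map_map (fun i => RTree.mk (c' i)) e
    (Finset.univ : Finset (Fin κ)).val
  rw [h2] at h3
  exact h1.trans h3.symm

theorem alpha_eq_of_iso {t u : PTree} (h : Iso t u) : alpha t = alpha u := by
  induction t generalizing u with
  | node κ c ih =>
    cases u with
    | node κ' c' =>
      obtain ⟨e, he⟩ := h
      obtain rfl : κ = κ' := Fin.equiv_iff_eq.1 ⟨e⟩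
      simp only [alpha]
      rw [branches_eq e he, ← Equiv.prod_comp e (fun i => alpha (c' i))]
      exact congrArg (fun z => z / _) (Finset.prod_congr rfl fun i _ => ih i (he i))

/-- `F([τ₁, …, τ_κ])(x) = f^(κ)(x)(F(τ₁)(x), …, F(τ_κ)(x))`; in particular `F(•)(x) = f(x)`. -/
noncomputable def elemDiff {d : ℕ} (f : State d → State d) (x : State d) : PTree → State d
  | node κ c => iteratedFDeriv ℝ κ f x fun i => elemDiff f x (c i)

theorem elemDiff_eq_of_iso {d : ℕ} {f : State d → State d} (hf : ContDiff ℝ (⊤ : ℕ∞) f) (x : State d)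
    {t u : PTree} (h : Iso t u) : elemDiff f x t = elemDiff f x u := by
  induction t generalizing u with
  | node κ c ih =>
    cases u with
    | node κ' c' =>
      obtain ⟨e, he⟩ := h
      obtain rfl : κ = κ' := Fin.equiv_iff_eq.1 ⟨e⟩
      simp only [elemDiff]
      have h1 : (fun i => elemDiff f x (c i)) = (fun i => elemDiff f x (c' i)) ∘ e :=
        funext fun i => ih i (he i)
      rw [h1]
      exact iteratedFDeriv_perm hf κ x _ e

/-- Stage weights: `Φ_i([τ₁, …, τ_κ]) = ∑_j a_{ij} ∏_k Φ_j(τ_k)`;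
in particular `Φ_i(•) = ∑_j a_{ij}`. -/
def stageCoeff {s : ℕ} (a : Matrix (Fin s) (Fin s) ℝ) : PTree → Fin s → ℝ
  | node _ c => fun i => ∑ j, a i j * ∏ k, stageCoeff a (c k) j

theorem stageCoeff_eq_of_iso {s : ℕ} (a : Matrix (Fin s) (Fin s) ℝ) {t u : PTree}
    (h : Iso t u) : stageCoeff a t = stageCoeff a u := by
  induction t generalizing u with
  | node κ c ih =>
    cases u with
    | node κ' c' =>
      obtain ⟨e, he⟩ := h
      funext i
      simp only [stageCoeff]
      refine Finset.sum_congr rfl fun j _ => ?_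
      rw [← Equiv.prod_comp e (fun k => stageCoeff a (c' k) j)]
      exact congrArg _ (Finset.prod_congr rfl fun k _ => by rw [ih k (he k)])

/-- Weights of the numerical solution: `Φ([τ₁, …, τ_κ]) = ∑_i b_i ∏_k Φ_i(τ_k)`, with the stage
weights `Φ_i` on the right; in particular `Φ(•) = ∑_i b_i`. -/
def solCoeff {s : ℕ} (a : Matrix (Fin s) (Fin s) ℝ) (b : Fin s → ℝ) : PTree → ℝ
  | node _ c => ∑ i, b i * ∏ k, stageCoeff a (c k) i

theorem solCoeff_eq_of_iso {s : ℕ} (a : Matrix (Fin s) (Fin s) ℝ) (b : Fin s → ℝ) {t u : PTree}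
    (h : Iso t u) : solCoeff a b t = solCoeff a b u := by
  cases t with
  | node κ c =>
    cases u with
    | node κ' c' =>
      obtain ⟨e, he⟩ := h
      simp only [solCoeff]
      refine Finset.sum_congr rfl fun i _ => ?_
      rw [← Equiv.prod_comp e (fun k => stageCoeff a (c' k) i)]
      exact congrArg _
        (Finset.prod_congr rfl fun k _ => by rw [stageCoeff_eq_of_iso a (he k)])

end PTree

/-- The set `T` of rooted trees: the empty tree and the nonempty rooted trees. -/
inductive Tree : Type
  | empty : Tree
  | ofRTree (τ : RTree) : Tree

namespace Tree

/-- `ρ(τ)`: the number of nodes. -/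
def order : Tree → ℕ
  | empty => 0
  | ofRTree τ => Quotient.lift PTree.order (fun _ _ h => PTree.order_eq_of_iso h) τ

theorem finite_order_le (N : ℕ) : {τ : Tree | order τ ≤ N}.Finite := by
  refine (((PTree.finite_order_le N).image
    fun t => ofRTree (RTree.mk t)).union (Set.finite_singleton empty)).subset ?_
  intro τ hτ
  cases τ with
  | empty => exact Or.inr rfl
  | ofRTree τ =>
    induction τ using Quotient.inductionOn with
    | h t => exact Or.inl ⟨t, hτ, rfl⟩

/-- The finite set of all rooted trees with at most `N` nodes. -/
noncomputable def upTo (N : ℕ) : Finset Tree := (finite_order_le N).toFinset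

/-- The combinatorial coefficient `α : T → ℚ`. -/
noncomputable def alpha : Tree → ℚ
  | empty => 1
  | ofRTree τ => Quotient.lift PTree.alpha (fun _ _ h => PTree.alpha_eq_of_iso h) τ

/-- The elementary differentials `F(τ)` of a smooth `f`. -/
noncomputable def elemDiff {d : ℕ} (f : State d → State d) (hf : ContDiff ℝ (⊤ : ℕ∞) f) :
    Tree → State d → State d
  | empty, x => x
  | ofRTree τ, x =>
    Quotient.lift (PTree.elemDiff f x) (fun _ _ h => PTree.elemDiff_eq_of_iso hf x h) τ

/-- The elementary weights of the `i`-th stage of the Runge–Kutta method. -/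
def stageCoeff {s : ℕ} (a : Matrix (Fin s) (Fin s) ℝ) (i : Fin s) : Tree → ℝ
  | empty => 1
  | ofRTree τ =>
    Quotient.lift (PTree.stageCoeff a) (fun _ _ h => PTree.stageCoeff_eq_of_iso a h) τ i

/-- The elementary weights of the numerical solution of the Runge–Kutta method. -/
def solCoeff {s : ℕ} (a : Matrix (Fin s) (Fin s) ℝ) (b : Fin s → ℝ) : Tree → ℝ
  | empty => 1
  | ofRTree τ =>
    Quotient.lift (PTree.solCoeff a b) (fun _ _ h => PTree.solCoeff_eq_of_iso a b h) τ

end Tree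

/-! ### B-series -/

/-- The partial sum over all trees with at most `N` nodes of the B-series
`B(φ, x; h) = ∑_τ α(τ) φ(τ)(h) F(τ)(x)`, at one realization `w τ` of the
random variables `φ(τ)(h)`. -/
noncomputable def bSum {d : ℕ} (f : State d → State d) (hf : ContDiff ℝ (⊤ : ℕ∞) f)
    (w : Tree → ℝ) (x : State d) (N : ℕ) : State d :=
  ∑ τ ∈ Tree.upTo N, ((τ.alpha : ℝ) * w τ) • τ.elemDiff f hf x

/-- The families `φ(τ)(h)` of random variables that are admitted as weights of a B-series:
`φ(∅) ≡ 1` and `φ(τ)(0) = 0` for `τ ≠ ∅`. -/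
structure IsWeight {Ω : Type*} [MeasurableSpace Ω] (P : MeasureTheory.Measure Ω)
    (φ : Tree → ℝ≥0 → Ω → ℝ) : Prop where
  aemeasurable : ∀ τ h, AEMeasurable (φ τ h) P
  empty : ∀ h ω, φ Tree.empty h ω = 1
  zero : ∀ τ, τ ≠ Tree.empty → ∀ ω, φ τ 0 ω = 0

/-- `Y(h) = B(φ, x; h)` as a formal series graded by the number of nodes, in which a tree with `ρ`
nodes counts as a term of size `|ΔM(h)| ^ ρ`: `φ` is an admissible family of weights and, for each
`N`, cutting the series after the trees with `N` nodes leaves a remainder of size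
`|ΔM(h)| ^ (N + 1)`, with constants that do not depend on `h` or on the realization `ω`. -/
def HasBSeries {d : ℕ} {Ω : Type*} [MeasurableSpace Ω] (P : MeasureTheory.Measure Ω)
    (f : State d → State d) (hf : ContDiff ℝ (⊤ : ℕ∞) f) (ΔM : ℝ≥0 → Ω → ℝ)
    (φ : Tree → ℝ≥0 → Ω → ℝ) (x : State d) (Y : ℝ≥0 → Ω → State d) : Prop :=
  IsWeight P φ ∧ ∀ N : ℕ, ∃ C : ℝ, ∃ δ > 0, ∀ h ω, |ΔM h ω| ≤ δ →
    ‖Y h ω - bSum f hf (fun τ => φ τ h ω) x N‖ ≤ C * |ΔM h ω| ^ (N + 1)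

/-- `Y(h) = B(φ, x; h)` almost surely as an asymptotic series for `h → 0`: `φ` is an admissible
family of weights and, for almost every path and each `N`, cutting the series after the trees with
`N` nodes leaves a remainder `O(|ΔM(h)| ^ (N + 1))` as `h → 0`. -/
def HasBSeriesAS {d : ℕ} {Ω : Type*} [MeasurableSpace Ω] (P : MeasureTheory.Measure Ω)
    (f : State d → State d) (hf : ContDiff ℝ (⊤ : ℕ∞) f) (ΔM : ℝ≥0 → Ω → ℝ)
    (φ : Tree → ℝ≥0 → Ω → ℝ) (x : State d) (Y : ℝ≥0 → Ω → State d) : Prop :=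
  IsWeight P φ ∧ ∀ᵐ ω ∂P, ∀ N : ℕ,
    (fun h => Y h ω - bSum f hf (fun τ => φ τ h ω) x N)
      =O[𝓝 (0 : ℝ≥0)] fun h => |ΔM h ω| ^ (N + 1)

/-! ### The method -/

/-- One step of the `s`-stage method with coefficients `a`, `b`, starting at `x`, with
increment `μ`: `H` are stage values and `y` is the numerical solution after the step. -/
def IsStep {d s : ℕ} (f : State d → State d) (a : Matrix (Fin s) (Fin s) ℝ) (b : Fin s → ℝ)
    (x : State d) (μ : ℝ) (H : Fin s → State d) (y : State d) : Prop :=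
  (∀ i, H i = x + μ • ∑ j, a i j • f (H j)) ∧ y = x + μ • ∑ i, b i • f (H i)

/-- The family of weights `ΔM(h) ^ ρ(τ) * c(τ)`. -/
def weight {Ω : Type*} (ΔM : ℝ≥0 → Ω → ℝ) (c : Tree → ℝ) : Tree → ℝ≥0 → Ω → ℝ :=
  fun τ h ω => ΔM h ω ^ τ.order * c τ

/-- The increment `M_t(h) = M(t + h) - M(t)` of the driving process `M(s) = lam s + σ W(s)`. -/
def drivingIncrement {Ω : Type*} (lam σ : ℝ) (W : ℝ≥0 → Ω → ℝ) (t : ℝ≥0) : ℝ≥0 → Ω → ℝ :=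
  fun h ω => lam * h + σ * (W (t + h) ω - W t ω)

end SRK

namespace SRK

/-! ### Taylor expansion -/

/-! Randomness plays no part in the expansion: the step depends on $h$ and on the realization only
through the number $\mu=\Delta M(h)$. For small $|\mu|$ the stage equations are a fixed-point
problem for a contraction, so every solution coincides with one deterministic function of $\mu$. It
suffices to expand that function as $\mu\to0$; substituting $\mu=\Delta M(h)$ then gives both the
uniform and the pathwise statement.

The expansion is by induction on the cut $N$ (`bSeries_isBigO`). If $H_j$ agrees with its series cut
at $N$ up to $O(\mu^{N+1})$, the Lipschitz condition allows $H_j$ to be replaced by the cut series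
inside $f$ at the same cost. Taylor's formula at $x$ and multilinearity turn the result into a sum
over tuples of trees. Tuples with the same join are the rearrangements of one another; by
orbit-stabilizer there are $\kappa!/(r_1!\cdots r_q!)$ of them, which against the Taylor factor
$1/\kappa!$ produces exactly $\alpha$ (`sum_join`, `comp_bSeries_isBigO`). The factor $\mu$ in front
of the sums in the step then raises the order of the remainder by one (`isBigO_step`). -/

theorem taylor_isBigO {E F : Type*} [NormedAddCommGroup E] [NormedSpace ℝ E]
    [NormedAddCommGroup F] [NormedSpace ℝ F] [CompleteSpace F] {f : E → F}
    (hf : ContDiff ℝ (⊤ : ℕ∞) f) (x : E) (n : ℕ) :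
    (fun y => f (x + y) - ∑ k ∈ Finset.range (n + 1),
      ((k.factorial : ℝ)⁻¹) • iteratedFDeriv ℝ k f x (fun _ => y))
      =O[𝓝 0] fun y => ‖y‖ ^ (n + 1) := by
  have hcont : Continuous (iteratedFDeriv ℝ (n + 1) f) :=
    hf.continuous_iteratedFDeriv (by exact_mod_cast le_top)
  -- On this ball the derivative of order `n + 1` stays within 1 of its value at `x`; hence the `+
  -- 1` in the constant that bounds the integral remainder.
  obtain ⟨ε, hε, hball⟩ := Metric.continuousAt_iff.1 (hcont.continuousAt (x := x)) 1 one_pos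
  refine Asymptotics.IsBigO.of_bound
    ((n.factorial : ℝ)⁻¹ * (‖iteratedFDeriv ℝ (n + 1) f x‖ + 1)) ?_
  filter_upwards [Metric.ball_mem_nhds (0 : E) hε] with y hy
  have hy' : ‖y‖ < ε := by simpa using hy
  have hcd : ∀ t ∈ Set.Icc (0 : ℝ) 1, ContDiffAt ℝ (n + 1) f (x + t • y) := fun t _ =>
    (hf.of_le (by exact_mod_cast le_top)).contDiffAt
  rw [map_add_eq_sum_add_integral_iteratedFDeriv hcd, add_sub_cancel_left, norm_smul, norm_inv,
    norm_pow, norm_norm, RCLike.norm_natCast, mul_assoc]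
  refine mul_le_mul_of_nonneg_left ?_ (by positivity)
  have hb : ∀ t ∈ Set.uIoc (0 : ℝ) 1,
      ‖(1 - t) ^ n • iteratedFDeriv ℝ (n + 1) f (x + t • y) (fun _ => y)‖ ≤
        (‖iteratedFDeriv ℝ (n + 1) f x‖ + 1) * ‖y‖ ^ (n + 1) := by
    intro t ht
    rw [Set.uIoc_of_le zero_le_one] at ht
    have h1 : ‖(1 - t) ^ n‖ ≤ 1 := by
      rw [norm_pow, Real.norm_of_nonneg (by linarith [ht.2])]
      exact pow_le_one₀ (by linarith [ht.2]) (by linarith [ht.1])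
    have h2 : dist (x + t • y) x < ε := by
      rw [dist_eq_norm, add_sub_cancel_left, norm_smul, Real.norm_of_nonneg ht.1.le]
      exact lt_of_le_of_lt (mul_le_of_le_one_left (norm_nonneg _) ht.2) hy'
    have h3 : ‖iteratedFDeriv ℝ (n + 1) f (x + t • y)‖ ≤ ‖iteratedFDeriv ℝ (n + 1) f x‖ + 1 := by
      have := hball h2
      rw [dist_eq_norm] at this
      linarith [norm_le_norm_add_norm_sub' (iteratedFDeriv ℝ (n + 1) f (x + t • y))
        (iteratedFDeriv ℝ (n + 1) f x)]
    have h4 := (iteratedFDeriv ℝ (n + 1) f (x + t • y)).le_opNorm fun _ => y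
    rw [Finset.prod_const, Finset.card_fin] at h4
    rw [norm_smul]
    refine (mul_le_of_le_one_left (norm_nonneg _) h1).trans (h4.trans ?_)
    gcongr
  simpa using intervalIntegral.norm_integral_le_of_norm_le_const hb

/-! ### Joining trees to a common root -/

theorem PTree.Iso.of_eq {t u : PTree} (h : t = u) : PTree.Iso t u :=
  h ▸ PTree.Iso.refl t

namespace RTree

/-- The tree `[q 0, …, q (κ - 1)]`. -/
noncomputable def join {κ : ℕ} (q : Fin κ → RTree) : RTree :=
  mk (PTree.node κ fun i => (q i).out)

theorem mk_out (τ : RTree) : mk (Quotient.out τ) = τ := Quotient.out_eq τ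

theorem join_mk {κ : ℕ} (c : Fin κ → PTree) :
    join (fun i => mk (c i)) = mk (PTree.node κ c) :=
  Quotient.sound ⟨Equiv.refl _, fun i => Quotient.exact (mk_out (mk (c i)))⟩

theorem exists_eq_join (τ : RTree) : ∃ (κ : ℕ) (q : Fin κ → RTree), τ = join q := by
  induction τ using Quotient.inductionOn with
  | h t =>
    cases t with
    | node κ c => exact ⟨κ, fun i => mk (c i), (join_mk c).symm⟩

/-- Isomorphism of ordered trees at the root is a matching of isomorphic branches, and isomorphic
branches are equal after passing to the quotient. -/
theorem join_eq_join_iff {κ κ' : ℕ} {q : Fin κ → RTree} {q' : Fin κ' → RTree} :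
    join q = join q' ↔ ∃ e : Fin κ ≃ Fin κ', ∀ i, q i = q' (e i) := by
  constructor
  · intro h
    obtain ⟨e, he⟩ : PTree.Iso _ _ := Quotient.exact h
    refine ⟨e, fun i => ?_⟩
    rw [← mk_out (q i), ← mk_out (q' (e i))]
    exact Quotient.sound (he i)
  · rintro ⟨e, he⟩
    refine Quotient.sound ⟨e, fun i => ?_⟩
    exact PTree.Iso.of_eq (congrArg Quotient.out (he i))

/-! ### Counting the rearrangements of a tuple of branches -/

theorem multFactorial_eq_card {κ : ℕ} (q : Fin κ → RTree) :
    open Classical in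
    multFactorial (Finset.univ.val.map q) =
      (Finset.univ.filter fun e : Equiv.Perm (Fin κ) => q ∘ e = q).card := by
  classical
  rw [← Fintype.card_subtype, DomMulAct.stabilizer_card', multFactorial]
  refine Finset.prod_congr ?_ fun i _ => ?_
  · ext; simp
  · rw [Multiset.count_map, Fintype.card_subtype]
    congr 1
    simp only [Finset.card, Finset.filter_val]
    congr 1
    exact Multiset.filter_congr fun _ _ => eq_comm

/-- Orbit-stabilizer for permutations acting on the positions of `q`: each fibre of `e ↦ q ∘ e` is a
coset of the stabilizer, whose size is `multFactorial`. -/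
theorem card_rearrangements_mul {κ : ℕ} (q : Fin κ → RTree) :
    open Classical in
    (Finset.univ.image fun e : Equiv.Perm (Fin κ) => q ∘ e).card *
      multFactorial (Finset.univ.val.map q) = κ.factorial := by
  classical
  have h := Finset.card_eq_sum_card_image (fun e : Equiv.Perm (Fin κ) => q ∘ e) Finset.univ
  rw [Finset.card_univ, Fintype.card_perm, Fintype.card_fin] at h
  rw [h, ← smul_eq_mul]
  refine (Finset.sum_eq_card_nsmul fun p hp => ?_).symm
  obtain ⟨e₀, -, rfl⟩ := Finset.mem_image.1 hp
  rw [multFactorial_eq_card]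
  refine Finset.card_bij' (fun e _ => e * e₀⁻¹) (fun e _ => e * e₀) ?_ ?_ ?_ ?_
  · intro e he
    have he : q ∘ e = q ∘ e₀ := by simpa using he
    simp only [Finset.mem_filter, Finset.mem_univ, true_and]
    rw [Equiv.Perm.coe_mul, ← Function.comp_assoc, he, Function.comp_assoc, ← Equiv.Perm.coe_mul]
    simp
  · intro e he
    have he : q ∘ e = q := by simpa using he
    simp only [Finset.mem_filter, Finset.mem_univ, true_and]
    rw [Equiv.Perm.coe_mul, ← Function.comp_assoc, he]
  · intro e _; simp
  · intro e _; simp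

end RTree

theorem multFactorial_ne_zero (m : Multiset RTree) : (multFactorial m : ℝ) ≠ 0 := by
  classical
  exact Nat.cast_ne_zero.2 (Finset.prod_ne_zero_iff.2 fun _ _ => Nat.factorial_ne_zero _)

/-! ### Recursions for order, coefficients and weights under joining -/

namespace Tree

theorem order_join {κ : ℕ} (q : Fin κ → RTree) :
    (ofRTree (RTree.join q)).order = 1 + ∑ i, (ofRTree (q i)).order := by
  change 1 + ∑ i, PTree.order (q i).out = _
  congr 1
  refine Finset.sum_congr rfl fun i _ => ?_
  conv_rhs => rw [← RTree.mk_out (q i)]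
  rfl

theorem alpha_join {κ : ℕ} (q : Fin κ → RTree) :
    (ofRTree (RTree.join q)).alpha =
      (∏ i, (ofRTree (q i)).alpha) / (multFactorial (Finset.univ.val.map q) : ℚ) := by
  change (∏ i, PTree.alpha (q i).out) / (multFactorial (PTree.branches _) : ℚ) = _
  have hb : PTree.branches (fun i => (q i).out) = Finset.univ.val.map q :=
    Multiset.map_congr rfl fun i _ => RTree.mk_out (q i)
  rw [hb]
  congr 1
  refine Finset.prod_congr rfl fun i _ => ?_
  conv_rhs => rw [← RTree.mk_out (q i)]
  rfl

theorem elemDiff_join {d : ℕ} {f : State d → State d} (hf : ContDiff ℝ (⊤ : ℕ∞) f) (x : State d)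
    {κ : ℕ} (q : Fin κ → RTree) :
    (ofRTree (RTree.join q)).elemDiff f hf x =
      iteratedFDeriv ℝ κ f x fun i => (ofRTree (q i)).elemDiff f hf x := by
  change iteratedFDeriv ℝ κ f x (fun i => PTree.elemDiff f x (q i).out) = _
  congr 1
  funext i
  conv_rhs => rw [← RTree.mk_out (q i)]
  rfl

/-- A stage is a numerical solution whose weights `b` are row `i` of `a`, so stages and solution can
be treated together. -/
theorem stageCoeff_eq_solCoeff {s : ℕ} (a : Matrix (Fin s) (Fin s) ℝ) (i : Fin s) :
    stageCoeff a i = solCoeff a (a i) := by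
  funext τ
  cases τ with
  | empty => rfl
  | ofRTree τ =>
    induction τ using Quotient.inductionOn with
    | h t => cases t; rfl

theorem solCoeff_join {s : ℕ} (a : Matrix (Fin s) (Fin s) ℝ) (b : Fin s → ℝ)
    {κ : ℕ} (q : Fin κ → RTree) :
    (ofRTree (RTree.join q)).solCoeff a b =
      ∑ i, b i * ∏ k, (ofRTree (q k)).stageCoeff a i := by
  change ∑ i, b i * ∏ k, PTree.stageCoeff a (q k).out i = _
  refine Finset.sum_congr rfl fun i _ => ?_
  congr 1
  refine Finset.prod_congr rfl fun k _ => ?_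
  conv_rhs => rw [← RTree.mk_out (q k)]
  rfl

/-- With a unit vector for `b` only the product $\prod_k\hat\Phi_j(\tau_k)$ survives. These are the
weights with which $f(H_j)$ itself expands. -/
theorem solCoeff_single_join {s : ℕ} (a : Matrix (Fin s) (Fin s) ℝ) (j : Fin s)
    {κ : ℕ} (q : Fin κ → RTree) :
    (ofRTree (RTree.join q)).solCoeff a (Pi.single j 1) =
      ∏ k, (ofRTree (q k)).stageCoeff a j := by
  rw [solCoeff_join, Finset.sum_eq_single j] <;> simp +contextual

theorem solCoeff_eq_sum_single {s : ℕ} (a : Matrix (Fin s) (Fin s) ℝ) (b : Fin s → ℝ)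
    (τ : RTree) :
    (ofRTree τ).solCoeff a b = ∑ j, b j * (ofRTree τ).solCoeff a (Pi.single j 1) := by
  obtain ⟨κ, q, rfl⟩ := RTree.exists_eq_join τ
  simp only [solCoeff_single_join, solCoeff_join a b]

theorem one_le_order (τ : RTree) : 1 ≤ (ofRTree τ).order := by
  obtain ⟨κ, q, rfl⟩ := RTree.exists_eq_join τ
  rw [order_join]
  exact Nat.le_add_right _ _

end Tree

/-! ### Sums over trees as sums over tuples of branches -/

/-- The finite set of all nonempty rooted trees with at most `N` nodes. -/
noncomputable def RTree.upTo (N : ℕ) : Finset RTree :=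
  (Tree.upTo N).preimage Tree.ofRTree fun _ _ _ _ h => Tree.ofRTree.inj h

theorem RTree.mem_upTo {N : ℕ} {τ : RTree} : τ ∈ RTree.upTo N ↔ (Tree.ofRTree τ).order ≤ N := by
  simp [RTree.upTo, Tree.upTo]

theorem Tree.sum_upTo {M : Type*} [AddCommMonoid M] (N : ℕ) (g : Tree → M) :
    ∑ τ ∈ Tree.upTo N, g τ = g Tree.empty + ∑ τ ∈ RTree.upTo N, g (Tree.ofRTree τ) := by
  classical
  have h : Tree.upTo N = insert Tree.empty ((RTree.upTo N).image Tree.ofRTree) := by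
    ext τ
    cases τ with
    | empty => simp [Tree.upTo, Tree.order]
    | ofRTree τ => simp [RTree.mem_upTo, Tree.upTo]
  rw [h, Finset.sum_insert (by simp), Finset.sum_image fun _ _ _ _ h => Tree.ofRTree.inj h]

/-- Summing over all trees is the same as summing over all tuples of branches, each tuple being
weighted with the proportion of its rearrangements that leave it unchanged. -/
theorem sum_join {M : Type*} [AddCommGroup M] [Module ℝ M] (N : ℕ) (G : RTree → M) :
    ∑ p ∈ ((Finset.range (N + 1)).sigma fun κ =>
        Fintype.piFinset fun _ : Fin κ => RTree.upTo N) with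
          (Tree.ofRTree (RTree.join p.2)).order ≤ N + 1,
      ((multFactorial (Finset.univ.val.map p.2) : ℝ) / (p.1.factorial : ℝ)) • G (RTree.join p.2) =
    ∑ τ ∈ RTree.upTo (N + 1), G τ := by
  classical
  rw [← Finset.sum_fiberwise_of_maps_to (t := RTree.upTo (N + 1))
    (g := fun p : Σ κ, (Fin κ → RTree) => RTree.join p.2)
    (fun p hp => RTree.mem_upTo.2 (Finset.mem_filter.1 hp).2)]
  refine Finset.sum_congr rfl fun τ hτ => ?_
  obtain ⟨κ, q, rfl⟩ := RTree.exists_eq_join τ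
  have hord := RTree.mem_upTo.1 hτ
  rw [Tree.order_join] at hord
  -- The root takes one of the at most `N + 1` nodes and every branch takes at least one. So no
  -- branch exceeds `N` nodes, there are at most `N` branches, and the index set misses no tree.
  have hq : ∀ i, q i ∈ RTree.upTo N := fun i => RTree.mem_upTo.2 <| by
    have := Finset.single_le_sum (f := fun i => (Tree.ofRTree (q i)).order)
      (fun _ _ => Nat.zero_le _) (Finset.mem_univ i)
    omega
  have hκ : κ < N + 1 := by
    have : ∑ _i : Fin κ, 1 ≤ ∑ i, (Tree.ofRTree (q i)).order :=
      Finset.sum_le_sum fun i _ => Tree.one_le_order (q i)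
    simp only [Finset.sum_const, Finset.card_univ, Fintype.card_fin, smul_eq_mul, mul_one] at this
    omega
  -- The tuples whose join is the given tree are exactly the rearrangements of `q`.
  have hfib : (((Finset.range (N + 1)).sigma fun κ =>
        Fintype.piFinset fun _ : Fin κ => RTree.upTo N).filter fun p =>
          (Tree.ofRTree (RTree.join p.2)).order ≤ N + 1).filter
        (fun p => RTree.join p.2 = RTree.join q) =
      (Finset.univ.image fun e : Equiv.Perm (Fin κ) => q ∘ e).image (Sigma.mk κ) := by
    ext ⟨κ', q'⟩
    simp only [Finset.mem_filter, Finset.mem_image, Finset.mem_univ, true_and,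
      Finset.mem_sigma, Finset.mem_range, Fintype.mem_piFinset]
    constructor
    · rintro ⟨-, h⟩
      obtain ⟨e, he⟩ := RTree.join_eq_join_iff.1 h
      obtain rfl : κ' = κ := Fin.equiv_iff_eq.1 ⟨e⟩
      exact ⟨q', ⟨e, funext fun i => (he i).symm⟩, rfl⟩
    · rintro ⟨p, ⟨e, rfl⟩, h⟩
      cases h
      have hj : RTree.join (q ∘ e) = RTree.join q := RTree.join_eq_join_iff.2 ⟨e, fun _ => rfl⟩
      refine ⟨⟨⟨hκ, fun i => hq _⟩, ?_⟩, hj⟩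
      rw [hj]
      exact RTree.mem_upTo.1 hτ
  rw [hfib, Finset.sum_image fun _ _ _ _ h => by simpa using h]
  have hconst : ∀ p ∈ Finset.univ.image fun e : Equiv.Perm (Fin κ) => q ∘ e,
      ((multFactorial (Finset.univ.val.map p) : ℝ) / (κ.factorial : ℝ)) • G (RTree.join p) =
      ((multFactorial (Finset.univ.val.map q) : ℝ) / (κ.factorial : ℝ)) • G (RTree.join q) := by
    intro p hp
    obtain ⟨e, -, rfl⟩ := Finset.mem_image.1 hp
    have hj : RTree.join (q ∘ e) = RTree.join q := RTree.join_eq_join_iff.2 ⟨e, fun _ => rfl⟩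
    have hm : Finset.univ.val.map (q ∘ e) = Finset.univ.val.map q := by
      rw [← Multiset.map_map]
      simp
    rw [hj, hm]
  rw [Finset.sum_congr rfl hconst, Finset.sum_const, ← Nat.cast_smul_eq_nsmul ℝ, smul_smul,
    mul_div_assoc', ← Nat.cast_mul, RTree.card_rearrangements_mul, div_self
    (Nat.cast_ne_zero.2 (Nat.factorial_ne_zero κ)), one_smul]

variable {d s : ℕ}

/-! ### Expansion of `f` along a B-series -/

/-- The term of `f (B(w, x))`, divided by `μ`, that belongs to the tree `τ`. Here `w'` maps
`[τ₁, …, τ_κ]` to `∏ w τ_k`. -/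
noncomputable def compTerm (f : State d → State d) (hf : ContDiff ℝ (⊤ : ℕ∞) f) (x : State d)
    (w' : RTree → ℝ) (μ : ℝ) (τ : RTree) : State d :=
  (((Tree.ofRTree τ).alpha : ℝ) * (μ ^ ((Tree.ofRTree τ).order - 1) * w' τ)) •
    (Tree.ofRTree τ).elemDiff f hf x

/-- A tuple of branches contributes to the Taylor polynomial a multiple of the term of the tree
obtained by joining them. -/
theorem iteratedFDeriv_branches {f : State d → State d} (hf : ContDiff ℝ (⊤ : ℕ∞) f) (x : State d)
    {w w' : RTree → ℝ} (hw : ∀ (κ : ℕ) (q : Fin κ → RTree), w' (RTree.join q) = ∏ k, w (q k))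
    (μ : ℝ) {κ : ℕ} (q : Fin κ → RTree) :
    (iteratedFDeriv ℝ κ f x fun k => (((Tree.ofRTree (q k)).alpha : ℝ) *
      (μ ^ (Tree.ofRTree (q k)).order * w (q k))) • (Tree.ofRTree (q k)).elemDiff f hf x) =
    (multFactorial (Finset.univ.val.map q) : ℝ) • compTerm f hf x w' μ (RTree.join q) := by
  -- The branch orders add up to the order of the join minus one, and `multFactorial` cancels the
  -- denominator in `alpha`.
  rw [ContinuousMultilinearMap.map_smul_univ, compTerm, Tree.elemDiff_join, smul_smul,
    Tree.alpha_join, Tree.order_join, hw, Nat.add_sub_cancel_left, Finset.prod_mul_distrib,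
    Finset.prod_mul_distrib, Finset.prod_pow_eq_pow_sum]
  congr 1
  push_cast
  have := multFactorial_ne_zero (Finset.univ.val.map q)
  field_simp

/-- Multilinearity: inserting a sum over trees in each of the `κ` slots gives a sum over `κ`-tuples
of trees. -/
theorem taylorPolynomial_eq_sum {f : State d → State d} (hf : ContDiff ℝ (⊤ : ℕ∞) f) (x : State d)
    {w w' : RTree → ℝ} (hw : ∀ (κ : ℕ) (q : Fin κ → RTree), w' (RTree.join q) = ∏ k, w (q k))
    (N : ℕ) (μ : ℝ) :
    ∑ κ ∈ Finset.range (N + 1), ((κ.factorial : ℝ)⁻¹) • iteratedFDeriv ℝ κ f x (fun _ =>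
      ∑ τ ∈ RTree.upTo N, (((Tree.ofRTree τ).alpha : ℝ) *
        (μ ^ (Tree.ofRTree τ).order * w τ)) • (Tree.ofRTree τ).elemDiff f hf x) =
    ∑ p ∈ (Finset.range (N + 1)).sigma fun κ => Fintype.piFinset fun _ : Fin κ => RTree.upTo N,
      ((multFactorial (Finset.univ.val.map p.2) : ℝ) / (p.1.factorial : ℝ)) •
        compTerm f hf x w' μ (RTree.join p.2) := by
  rw [Finset.sum_sigma]
  refine Finset.sum_congr rfl fun κ _ => ?_
  rw [ContinuousMultilinearMap.map_sum_finset, Finset.smul_sum]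
  refine Finset.sum_congr rfl fun q _ => ?_
  rw [iteratedFDeriv_branches hf x hw, smul_smul, div_eq_inv_mul]

theorem pow_isBigO_pow {m n : ℕ} (h : n ≤ m) :
    (fun μ : ℝ => μ ^ m) =O[𝓝 0] fun μ : ℝ => μ ^ n := by
  refine Asymptotics.IsBigO.of_bound 1 ?_
  filter_upwards [Metric.closedBall_mem_nhds (0 : ℝ) one_pos] with μ hμ
  rw [one_mul, norm_pow, norm_pow]
  exact pow_le_pow_of_le_one (norm_nonneg _) (by simpa using hμ) h

theorem monomial_isBigO {E : Type*} [NormedAddCommGroup E] [NormedSpace ℝ E] {m n : ℕ}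
    (h : n ≤ m) (c c' : ℝ) (v : E) :
    (fun μ : ℝ => (c * (μ ^ m * c')) • v) =O[𝓝 0] fun μ : ℝ => μ ^ n := by
  have h1 : (fun μ : ℝ => (c * (μ ^ m * c')) • v) = fun μ : ℝ => μ ^ m • ((c * c') • v) := by
    funext μ
    rw [smul_smul]
    ring_nf
  rw [h1]
  refine Asymptotics.IsBigO.trans ?_ (pow_isBigO_pow h)
  refine Asymptotics.IsBigO.of_bound ‖(c * c') • v‖ (.of_forall fun μ => ?_)
  rw [norm_smul, mul_comm]

/-- Trees with up to `N + 1` nodes appear although the argument is cut at `N`, since joining adds a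
root without a power of `μ`. The error has two sources: the Taylor remainder, as the cut series
differs from `x` by $O(\mu)$, and the tuples whose join is too large. -/
theorem comp_bSeries_isBigO {f : State d → State d} (hf : ContDiff ℝ (⊤ : ℕ∞) f) (x : State d)
    {w w' : RTree → ℝ} (hw : ∀ (κ : ℕ) (q : Fin κ → RTree), w' (RTree.join q) = ∏ k, w (q k))
    (N : ℕ) :
    (fun μ : ℝ => f (x + ∑ τ ∈ RTree.upTo N, (((Tree.ofRTree τ).alpha : ℝ) *
        (μ ^ (Tree.ofRTree τ).order * w τ)) • (Tree.ofRTree τ).elemDiff f hf x) -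
      ∑ τ ∈ RTree.upTo (N + 1), compTerm f hf x w' μ τ) =O[𝓝 0] fun μ : ℝ => μ ^ (N + 1) := by
  set v : ℝ → State d := fun μ => ∑ τ ∈ RTree.upTo N, (((Tree.ofRTree τ).alpha : ℝ) *
    (μ ^ (Tree.ofRTree τ).order * w τ)) • (Tree.ofRTree τ).elemDiff f hf x with hv
  have hvO : v =O[𝓝 0] fun μ : ℝ => μ := by
    have h : v =O[𝓝 0] fun μ : ℝ => μ ^ 1 :=
      Asymptotics.IsBigO.fun_sum fun τ _ => monomial_isBigO (Tree.one_le_order τ) _ _ _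
    simpa using h
  have hv0 : Filter.Tendsto v (𝓝 0) (𝓝 0) := hvO.trans_tendsto Filter.tendsto_id
  have h1 := ((taylor_isBigO hf x N).comp_tendsto hv0).trans (hvO.norm_left.pow (N + 1))
  have h2 : (fun μ : ℝ => ∑ p ∈ ((Finset.range (N + 1)).sigma fun κ =>
        Fintype.piFinset fun _ : Fin κ => RTree.upTo N) with
          ¬ (Tree.ofRTree (RTree.join p.2)).order ≤ N + 1,
      ((multFactorial (Finset.univ.val.map p.2) : ℝ) / (p.1.factorial : ℝ)) •
        compTerm f hf x w' μ (RTree.join p.2)) =O[𝓝 0] fun μ : ℝ => μ ^ (N + 1) := by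
    refine Asymptotics.IsBigO.fun_sum fun p hp => ?_
    -- A join with at least `N + 2` nodes carries the power `order - 1`, which is still at least `N
    -- + 1`.
    have hord : N + 1 ≤ (Tree.ofRTree (RTree.join p.2)).order - 1 := by
      have := (Finset.mem_filter.1 hp).2
      omega
    have hterm : (fun μ : ℝ => compTerm f hf x w' μ (RTree.join p.2)) =O[𝓝 0]
        fun μ : ℝ => μ ^ (N + 1) := monomial_isBigO hord _ _ _
    exact hterm.const_smul_left
      ((multFactorial (Finset.univ.val.map p.2) : ℝ) / (p.1.factorial : ℝ))
  refine (h1.add h2).congr_left fun μ => ?_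
  simp only [Function.comp_apply]
  have h3 := taylorPolynomial_eq_sum hf x hw N μ
  rw [← Finset.sum_filter_add_sum_filter_not ((Finset.range (N + 1)).sigma _)
    (fun p : Σ κ, (Fin κ → RTree) => (Tree.ofRTree (RTree.join p.2)).order ≤ N + 1)
    (f := fun p => _ • _), sum_join N] at h3
  rw [hv, h3]
  abel

/-! ### Steps of the method -/

theorem bSum_pow_mul (f : State d → State d) (hf : ContDiff ℝ (⊤ : ℕ∞) f) (x : State d)
    {c : Tree → ℝ} (hc : c Tree.empty = 1) (N : ℕ) (μ : ℝ) :
    bSum f hf (fun τ => μ ^ τ.order * c τ) x N =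
      x + ∑ τ ∈ RTree.upTo N, (((Tree.ofRTree τ).alpha : ℝ) *
        (μ ^ (Tree.ofRTree τ).order * c (Tree.ofRTree τ))) •
          (Tree.ofRTree τ).elemDiff f hf x := by
  rw [bSum, Tree.sum_upTo]
  simp [Tree.alpha, Tree.order, Tree.elemDiff, hc]

theorem bSum_solCoeff_zero (f : State d → State d) (hf : ContDiff ℝ (⊤ : ℕ∞) f) (x : State d)
    (a : Matrix (Fin s) (Fin s) ℝ) (b : Fin s → ℝ) (μ : ℝ) :
    bSum f hf (fun τ => μ ^ τ.order * τ.solCoeff a b) x 0 = x := by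
  have h : RTree.upTo 0 = ∅ := by
    ext τ
    have := Tree.one_le_order τ
    simp only [RTree.mem_upTo, Finset.notMem_empty, iff_false]
    omega
  rw [bSum_pow_mul f hf x rfl, h, Finset.sum_empty, add_zero]

/-- The cut series has the exact shape of the step, with $f(H_j)$ replaced by its own expansion;
only the errors in $f(H_j)$ then remain to be compared. -/
theorem bSum_solCoeff (f : State d → State d) (hf : ContDiff ℝ (⊤ : ℕ∞) f) (x : State d)
    (a : Matrix (Fin s) (Fin s) ℝ) (b : Fin s → ℝ) (N : ℕ) (μ : ℝ) :
    bSum f hf (fun τ => μ ^ τ.order * τ.solCoeff a b) x N =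
      x + μ • ∑ j, b j • ∑ τ ∈ RTree.upTo N, compTerm f hf x
        (fun τ => (Tree.ofRTree τ).solCoeff a (Pi.single j 1)) μ τ := by
  rw [bSum_pow_mul f hf x rfl]
  simp only [compTerm, Finset.smul_sum]
  rw [Finset.sum_comm]
  congr 1
  refine Finset.sum_congr rfl fun τ _ => ?_
  rw [Tree.solCoeff_eq_sum_single a b τ]
  simp only [smul_smul]
  rw [← Finset.sum_smul, Finset.mul_sum, Finset.mul_sum]
  congr 1
  refine Finset.sum_congr rfl fun j _ => ?_
  -- Every nonempty tree has a node, so the outer factor `μ` can be split off.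
  rw [← mul_pow_sub_one (Nat.one_le_iff_ne_zero.1 (Tree.one_le_order τ)) μ]
  ring

/-- The gain of one order comes from the factor `μ` in the step. With `b` a row of `a` this applies
to the stages as well. -/
theorem isBigO_step {f : State d → State d} {x : State d} {b : Fin s → ℝ} {H : ℝ → Fin s → State d}
    {y : ℝ → State d} (hy : ∀ᶠ μ in 𝓝 0, y μ = x + μ • ∑ i, b i • f (H μ i))
    {g : Fin s → ℝ → State d} {n : ℕ}
    (hg : ∀ j, (fun μ => f (H μ j) - g j μ) =O[𝓝 0] fun μ : ℝ => μ ^ n) :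
    (fun μ => y μ - (x + μ • ∑ j, b j • g j μ)) =O[𝓝 0] fun μ : ℝ => μ ^ (n + 1) := by
  have h1 : (fun μ => μ • ∑ j, b j • (f (H μ j) - g j μ)) =O[𝓝 0] fun μ : ℝ => μ • μ ^ n :=
    (Asymptotics.isBigO_refl (fun μ : ℝ => μ) _).smul
      (Asymptotics.IsBigO.fun_sum fun j _ => show (b j • fun μ => f (H μ j) - g j μ) =O[𝓝 0] _ from
        (hg j).const_smul_left _)
  simp only [smul_eq_mul, ← pow_succ'] at h1
  refine h1.congr' ?_ Filter.EventuallyEq.rfl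
  filter_upwards [hy] with μ hμ
  simp only [hμ, smul_sub, Finset.sum_sub_distrib]
  abel

/-! ### Solvability of the stage equations by contraction -/

/-- The right-hand side of the stage equations, as a map of the stage values. -/
def stageMap (f : State d → State d) (a : Matrix (Fin s) (Fin s) ℝ) (x : State d) (μ : ℝ)
    (H : Fin s → State d) : Fin s → State d :=
  fun i => x + μ • ∑ j, a i j • f (H j)

theorem lipschitzWith_stageMap {f : State d → State d} {K : ℝ≥0} (hK : LipschitzWith K f)
    (a : Matrix (Fin s) (Fin s) ℝ) (x : State d) (μ : ℝ) :
    LipschitzWith (‖μ‖₊ * ((∑ i, ∑ j, ‖a i j‖₊) * K)) (stageMap f a x μ) := by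
  refine LipschitzWith.of_dist_le_mul fun H H' => ?_
  refine (dist_pi_le_iff (by positivity)).2 fun i => ?_
  simp only [stageMap, dist_add_left, dist_smul₀]
  push_cast
  rw [mul_assoc]
  refine mul_le_mul_of_nonneg_left ?_ (norm_nonneg μ)
  have h1 : dist (∑ j, a i j • f (H j)) (∑ j, a i j • f (H' j)) ≤
      ∑ j, ‖a i j‖ * (K * dist H H') := by
    refine (dist_sum_sum_le _ _ _).trans (Finset.sum_le_sum fun j _ => ?_)
    rw [dist_smul₀]
    refine mul_le_mul_of_nonneg_left ?_ (norm_nonneg _)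
    exact (hK.dist_le_mul _ _).trans
      (mul_le_mul_of_nonneg_left (dist_le_pi_dist H H' j) K.coe_nonneg)
  refine h1.trans ?_
  rw [← Finset.sum_mul, mul_assoc]
  refine mul_le_mul_of_nonneg_right ?_ (by positivity)
  exact Finset.single_le_sum (f := fun i => ∑ j, ‖a i j‖)
    (fun i _ => Finset.sum_nonneg fun j _ => norm_nonneg _) (Finset.mem_univ i)

theorem exists_contracting_stageMap {f : State d → State d} (hLip : ∃ K : ℝ≥0, LipschitzWith K f)
    (a : Matrix (Fin s) (Fin s) ℝ) (x : State d) :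
    ∃ r > 0, ∀ μ : ℝ, |μ| ≤ r → ContractingWith (1 / 2) (stageMap f a x μ) := by
  obtain ⟨K, hK⟩ := hLip
  set L : ℝ≥0 := (∑ i, ∑ j, ‖a i j‖₊) * K with hL
  -- Chosen so that `|μ| * L ≤ 1 / 2`; the `+ 1` keeps the denominator positive when `L = 0`.
  refine ⟨1 / (2 * (L + 1)), by positivity, fun μ hμ => ⟨by norm_num, ?_⟩⟩
  refine (lipschitzWith_stageMap hK a x μ).weaken ?_
  rw [← hL, ← NNReal.coe_le_coe]
  push_cast
  calc ‖μ‖ * (L : ℝ) ≤ 1 / (2 * (L + 1)) * (L + 1) :=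
        mul_le_mul hμ (by linarith) L.coe_nonneg (by positivity)
    _ = 1 / 2 := by
        have : (L : ℝ) + 1 ≠ 0 := by positivity
        field_simp

theorem IsStep.isFixedPt {f : State d → State d} {a : Matrix (Fin s) (Fin s) ℝ} {b : Fin s → ℝ}
    {x : State d} {μ : ℝ} {H : Fin s → State d} {y : State d} (h : IsStep f a b x μ H y) :
    Function.IsFixedPt (stageMap f a x μ) H :=
  funext fun i => (h.1 i).symm

theorem existsUnique_isStep {f : State d → State d} {a : Matrix (Fin s) (Fin s) ℝ} (b : Fin s → ℝ)
    {x : State d} {μ : ℝ} (h : ContractingWith (1 / 2) (stageMap f a x μ)) :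
    ∃! p : (Fin s → State d) × State d, IsStep f a b x μ p.1 p.2 := by
  have hfix := h.fixedPoint_isFixedPt
  refine ⟨(h.fixedPoint _, x + μ • ∑ i, b i • f (h.fixedPoint _ i)),
    ⟨fun i => (congrFun hfix i).symm, rfl⟩, ?_⟩
  rintro ⟨H, y⟩ hp
  obtain rfl : H = h.fixedPoint _ := h.fixedPoint_unique hp.isFixedPt
  exact Prod.ext rfl hp.2

/-- The values of `f` at the stages remain bounded as the increment tends to zero. -/
theorem stages_isBigO_one {f : State d → State d} (hLip : ∃ K : ℝ≥0, LipschitzWith K f)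
    {a : Matrix (Fin s) (Fin s) ℝ} {b : Fin s → ℝ} {x : State d} {H : ℝ → Fin s → State d}
    {y : ℝ → State d} (h : ∀ᶠ μ in 𝓝 0, IsStep f a b x μ (H μ) (y μ)) (j : Fin s) :
    (fun μ => f (H μ j)) =O[𝓝 0] fun _ => (1 : ℝ) := by
  obtain ⟨r, hr, hcon⟩ := exists_contracting_stageMap hLip a x
  obtain ⟨K, hK⟩ := hLip
  -- The displacement of the constant stages `x` is proportional to `|μ|`, so its value at `μ = 1`
  -- dominates for `|μ| ≤ 1`.
  set C : ℝ := dist (fun _ : Fin s => x) (stageMap f a x 1 fun _ => x) with hC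
  refine Asymptotics.IsBigO.of_bound (‖f x‖ + K * (2 * C)) ?_
  filter_upwards [h, Metric.closedBall_mem_nhds (0 : ℝ) hr,
    Metric.closedBall_mem_nhds (0 : ℝ) one_pos] with μ hμ hμr hμ1
  have hc := hcon μ (by simpa using hμr)
  have hμ1 : ‖μ‖ ≤ 1 := by simpa using hμ1
  have h1 : dist (fun _ : Fin s => x) (stageMap f a x μ fun _ => x) ≤ C := by
    refine (dist_pi_le_iff dist_nonneg).2 fun i => ?_
    refine le_trans ?_ (dist_le_pi_dist _ _ i)
    simp only [stageMap, dist_self_add_right, norm_smul, norm_one, one_mul]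
    exact mul_le_of_le_one_left (norm_nonneg _) hμ1
  -- Banach's a priori bound: the distance to the fixed point is at most the first displacement
  -- divided by `1 - 1/2`.
  have h2 : dist (fun _ : Fin s => x) (H μ) ≤ 2 * C := by
    have h3 := hc.dist_fixedPoint_le (fun _ : Fin s => x)
    rw [← hc.fixedPoint_unique hμ.isFixedPt] at h3
    norm_num at h3
    linarith
  have h4 : ‖f (H μ j) - f x‖ ≤ K * (2 * C) := by
    rw [← dist_eq_norm, dist_comm]
    exact (hK.dist_le_mul _ _).trans (mul_le_mul_of_nonneg_left
      ((dist_le_pi_dist (fun _ : Fin s => x) (H μ) j).trans h2) K.coe_nonneg)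
  rw [norm_one, mul_one]
  linarith [norm_le_norm_add_norm_sub' (f (H μ j)) (f x)]

theorem bSeries_isBigO {f : State d → State d} (hf : ContDiff ℝ (⊤ : ℕ∞) f)
    (hLip : ∃ K : ℝ≥0, LipschitzWith K f)
    {a : Matrix (Fin s) (Fin s) ℝ} {b : Fin s → ℝ} {x : State d} {H : ℝ → Fin s → State d}
    {y : ℝ → State d} (h : ∀ᶠ μ in 𝓝 0, IsStep f a b x μ (H μ) (y μ)) (N : ℕ) :
    (∀ i, (fun μ => H μ i - bSum f hf (fun τ => μ ^ τ.order * τ.stageCoeff a i) x N)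
      =O[𝓝 0] fun μ : ℝ => μ ^ (N + 1)) ∧
    (fun μ => y μ - bSum f hf (fun τ => μ ^ τ.order * τ.solCoeff a b) x N)
      =O[𝓝 0] fun μ : ℝ => μ ^ (N + 1) := by
  have hH : ∀ i, ∀ᶠ μ in 𝓝 0, H μ i = x + μ • ∑ j, a i j • f (H μ j) := fun i =>
    h.mono fun μ hμ => hμ.1 i
  have hy : ∀ᶠ μ in 𝓝 0, y μ = x + μ • ∑ j, b j • f (H μ j) := h.mono fun μ hμ => hμ.2
  simp only [Tree.stageCoeff_eq_solCoeff]
  induction N with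
  | zero =>
    -- At the start `f (H μ j)` is approximated by zero with a bounded error; the factor `μ` makes
    -- this $O(\mu)$.
    have hg : ∀ j, (fun μ => f (H μ j) - 0) =O[𝓝 0] fun μ : ℝ => μ ^ 0 := fun j => by
      simpa using stages_isBigO_one hLip h j
    simp only [bSum_solCoeff_zero]
    exact ⟨fun i => by simpa using isBigO_step (hH i) hg, by simpa using isBigO_step hy hg⟩
  | succ N ih =>
    have hg : ∀ j, (fun μ => f (H μ j) - ∑ τ ∈ RTree.upTo (N + 1), compTerm f hf x
        (fun τ => (Tree.ofRTree τ).solCoeff a (Pi.single j 1)) μ τ)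
          =O[𝓝 0] fun μ : ℝ => μ ^ (N + 1) := by
      intro j
      have h1 := comp_bSeries_isBigO hf x
        (w := fun τ => (Tree.ofRTree τ).stageCoeff a j)
        (w' := fun τ => (Tree.ofRTree τ).solCoeff a (Pi.single j 1))
        (fun κ q => Tree.solCoeff_single_join a j q) N
      have h2 := ih.1 j
      simp only [← Tree.stageCoeff_eq_solCoeff,
        bSum_pow_mul f hf x (c := Tree.stageCoeff a j) rfl] at h2
      obtain ⟨K, hK⟩ := hLip
      -- The Lipschitz condition carries the induction hypothesis through `f`.
      have h3 : (fun μ => f (H μ j) - f (x + ∑ τ ∈ RTree.upTo N, (((Tree.ofRTree τ).alpha : ℝ) *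
          (μ ^ (Tree.ofRTree τ).order * (Tree.ofRTree τ).stageCoeff a j)) •
            (Tree.ofRTree τ).elemDiff f hf x)) =O[𝓝 0] fun μ : ℝ => μ ^ (N + 1) :=
        (Asymptotics.IsBigO.of_bound K (.of_forall fun μ => hK.norm_sub_le _ _)).trans h2
      exact (h3.add h1).congr_left fun μ => by abel
    simp only [bSum_solCoeff _ _ _ _ _ (N + 1)]
    exact ⟨fun i => isBigO_step (hH i) hg, isBigO_step hy hg⟩

/-- The step, as a function of the increment, solves the equations and has the expansions
uniformly: any two solutions agree for small increments. -/
theorem exists_step_function {f : State d → State d} (hf : ContDiff ℝ (⊤ : ℕ∞) f)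
    (hLip : ∃ K : ℝ≥0, LipschitzWith K f)
    (a : Matrix (Fin s) (Fin s) ℝ) (b : Fin s → ℝ) (x : State d) :
    ∃ (H₀ : ℝ → Fin s → State d) (y₀ : ℝ → State d),
      (∀ᶠ μ in 𝓝 0, ∀ H y, IsStep f a b x μ H y → H = H₀ μ ∧ y = y₀ μ) ∧
      ∀ N : ℕ,
        (∀ i, (fun μ => H₀ μ i - bSum f hf (fun τ => μ ^ τ.order * τ.stageCoeff a i) x N)
          =O[𝓝 0] fun μ : ℝ => μ ^ (N + 1)) ∧
        (fun μ => y₀ μ - bSum f hf (fun τ => μ ^ τ.order * τ.solCoeff a b) x N)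
          =O[𝓝 0] fun μ : ℝ => μ ^ (N + 1) := by
  obtain ⟨r, hr, hcon⟩ := exists_contracting_stageMap hLip a x
  have hex : ∀ μ : ℝ, ∃ p : (Fin s → State d) × State d, |μ| ≤ r → IsStep f a b x μ p.1 p.2 :=
    fun μ => by
      by_cases hμ : |μ| ≤ r
      · exact (existsUnique_isStep b (hcon μ hμ)).exists.imp fun p hp _ => hp
      -- An arbitrary value for large increments, where nothing is claimed.
      · exact ⟨(0, 0), fun h => absurd h hμ⟩
  choose p hp using hex
  have hsmall : ∀ᶠ μ : ℝ in 𝓝 0, |μ| ≤ r := by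
    filter_upwards [Metric.closedBall_mem_nhds (0 : ℝ) hr] with μ hμ
    simpa using hμ
  refine ⟨fun μ => (p μ).1, fun μ => (p μ).2, ?_, fun N => bSeries_isBigO hf hLip
    (hsmall.mono fun μ hμ => hp μ hμ) N⟩
  filter_upwards [hsmall] with μ hμ H y hstep
  have := (existsUnique_isStep b (hcon μ hμ)).unique (y₁ := (H, y)) (y₂ := p μ) hstep (hp μ hμ)
  exact ⟨congrArg Prod.fst this, congrArg Prod.snd this⟩

/-! ### From expansions in the increment to random series -/

theorem isWeight_weight {Ω : Type*} [MeasurableSpace Ω] {P : MeasureTheory.Measure Ω}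
    {ΔM : ℝ≥0 → Ω → ℝ} (hm : ∀ h, AEMeasurable (ΔM h) P) (h0 : ∀ ω, ΔM 0 ω = 0)
    {c : Tree → ℝ} (hc : c Tree.empty = 1) : IsWeight P (weight ΔM c) where
  aemeasurable τ h := ((hm h).pow_const _).mul_const _
  empty h ω := by simp [weight, Tree.order, hc]
  zero τ hτ ω := by
    cases τ with
    | empty => exact absurd rfl hτ
    | ofRTree τ =>
      simp [weight, h0, Nat.one_le_iff_ne_zero.1 (Tree.one_le_order τ)]

/-- The constant and the radius belong to the real function `Z` alone, so they are uniform in `h`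
and `ω`. -/
theorem hasBSeries_of_isBigO {Ω : Type*} [MeasurableSpace Ω] {P : MeasureTheory.Measure Ω}
    {f : State d → State d} (hf : ContDiff ℝ (⊤ : ℕ∞) f) {ΔM : ℝ≥0 → Ω → ℝ}
    (hm : ∀ h, AEMeasurable (ΔM h) P) (h0 : ∀ ω, ΔM 0 ω = 0)
    {c : Tree → ℝ} (hc : c Tree.empty = 1) {x : State d} {Y : ℝ≥0 → Ω → State d} {Z : ℝ → State d}
    (hYZ : ∃ r > 0, ∀ h ω, |ΔM h ω| ≤ r → Y h ω = Z (ΔM h ω))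
    (hZ : ∀ N : ℕ, (fun μ => Z μ - bSum f hf (fun τ => μ ^ τ.order * c τ) x N)
      =O[𝓝 0] fun μ : ℝ => μ ^ (N + 1)) :
    HasBSeries P f hf ΔM (weight ΔM c) x Y := by
  refine ⟨isWeight_weight hm h0 hc, fun N => ?_⟩
  obtain ⟨r, hr, hYZ⟩ := hYZ
  obtain ⟨C, hC⟩ := (hZ N).bound
  obtain ⟨ε, hε, hball⟩ := Metric.nhds_basis_closedBall.eventually_iff.1 hC
  refine ⟨C, min r ε, lt_min hr hε, fun h ω hω => ?_⟩
  rw [hYZ h ω (hω.trans (min_le_left _ _))]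
  have := hball (x := ΔM h ω) (by simpa using hω.trans (min_le_right _ _))
  simpa [weight] using this

/-- Here the expansion of `Z` is composed with a path along which the increment tends to zero. -/
theorem hasBSeriesAS_of_isBigO {Ω : Type*} [MeasurableSpace Ω] {P : MeasureTheory.Measure Ω}
    {f : State d → State d} (hf : ContDiff ℝ (⊤ : ℕ∞) f) {ΔM : ℝ≥0 → Ω → ℝ}
    (hm : ∀ h, AEMeasurable (ΔM h) P) (h0 : ∀ ω, ΔM 0 ω = 0)
    (hlim : ∀ᵐ ω ∂P, Filter.Tendsto (fun h => ΔM h ω) (𝓝 0) (𝓝 0))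
    {c : Tree → ℝ} (hc : c Tree.empty = 1) {x : State d} {Y : ℝ≥0 → Ω → State d} {Z : ℝ → State d}
    (hYZ : ∀ᵐ ω ∂P, ∀ᶠ h in 𝓝 (0 : ℝ≥0), Y h ω = Z (ΔM h ω))
    (hZ : ∀ N : ℕ, (fun μ => Z μ - bSum f hf (fun τ => μ ^ τ.order * c τ) x N)
      =O[𝓝 0] fun μ : ℝ => μ ^ (N + 1)) :
    HasBSeriesAS P f hf ΔM (weight ΔM c) x Y := by
  refine ⟨isWeight_weight hm h0 hc, ?_⟩
  filter_upwards [hlim, hYZ] with ω hω hYω N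
  have h1 := ((hZ N).comp_tendsto hω).norm_right
  refine h1.congr' ?_ (.of_forall fun h => ?_)
  · filter_upwards [hYω] with h hh
    simp [weight, hh]
  · simp

end SRK

theorem theorem5 {d s : ℕ} {Ω : Type*} [MeasurableSpace Ω]
    (P : MeasureTheory.Measure Ω) [MeasureTheory.IsProbabilityMeasure P]
    (f : SRK.State d → SRK.State d) (hf : ContDiff ℝ (⊤ : ℕ∞) f)
    (hLip : ∃ K : ℝ≥0, LipschitzWith K f)
    (a : Matrix (Fin s) (Fin s) ℝ) (b : Fin s → ℝ) (x : SRK.State d) :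
    -- the step is well defined for small increments
    (∃ r > 0, ∀ μ : ℝ, |μ| ≤ r →
      ∃! p : (Fin s → SRK.State d) × SRK.State d, SRK.IsStep f a b x μ p.1 p.2) ∧
    -- an arbitrary random increment, exact or simulated
    (∀ (ΔM : ℝ≥0 → Ω → ℝ), (∀ h, AEMeasurable (ΔM h) P) → (∀ ω, ΔM 0 ω = 0) →
      ∀ (H : Fin s → ℝ≥0 → Ω → SRK.State d) (Y : ℝ≥0 → Ω → SRK.State d),
        (∃ r > 0, ∀ h ω, |ΔM h ω| ≤ r →
          SRK.IsStep f a b x (ΔM h ω) (fun i => H i h ω) (Y h ω)) →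
        (∀ i, SRK.HasBSeries P f hf ΔM
          (SRK.weight ΔM (SRK.Tree.stageCoeff a i)) x (H i)) ∧
        SRK.HasBSeries P f hf ΔM (SRK.weight ΔM (SRK.Tree.solCoeff a b)) x Y) ∧
    -- the increment of the driving process itself, along almost every path
    (∀ (W : ℝ≥0 → Ω → ℝ), ProbabilityTheory.IsBrownianReal W P →
      ∀ (lam σ : ℝ) (t : ℝ≥0)
        (H : Fin s → ℝ≥0 → Ω → SRK.State d) (Y : ℝ≥0 → Ω → SRK.State d),
        (∀ᵐ ω ∂P, ∀ᶠ h in 𝓝 (0 : ℝ≥0),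
          SRK.IsStep f a b x (SRK.drivingIncrement lam σ W t h ω)
            (fun i => H i h ω) (Y h ω)) →
        (∀ i, SRK.HasBSeriesAS P f hf (SRK.drivingIncrement lam σ W t)
          (SRK.weight (SRK.drivingIncrement lam σ W t) (SRK.Tree.stageCoeff a i)) x (H i)) ∧
        SRK.HasBSeriesAS P f hf (SRK.drivingIncrement lam σ W t)
          (SRK.weight (SRK.drivingIncrement lam σ W t) (SRK.Tree.solCoeff a b)) x Y) := by
  -- These functions of `μ` are fixed before any random increment or any solution is given, so one
  -- expansion serves both parts.
  obtain ⟨H₀, y₀, huniq, hexp⟩ := SRK.exists_step_function hf hLip a b x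
  refine ⟨?_, ?_, ?_⟩
  · obtain ⟨r, hr, hcon⟩ := SRK.exists_contracting_stageMap hLip a x
    exact ⟨r, hr, fun μ hμ => SRK.existsUnique_isStep b (hcon μ hμ)⟩
  · rintro ΔM hm h0 H Y ⟨r, hr, hstep⟩
    obtain ⟨ε, hε, hball⟩ := Metric.nhds_basis_closedBall.eventually_iff.1 huniq
    have hsol : ∀ h ω, |ΔM h ω| ≤ min r ε →
        (fun i => H i h ω) = H₀ (ΔM h ω) ∧ Y h ω = y₀ (ΔM h ω) := fun h ω hω =>
      hball (by simpa using hω.trans (min_le_right _ _)) _ _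
        (hstep h ω (hω.trans (min_le_left _ _)))
    exact ⟨fun i => SRK.hasBSeries_of_isBigO hf hm h0 rfl (Z := fun μ => H₀ μ i)
        ⟨min r ε, lt_min hr hε, fun h ω hω => congrFun (hsol h ω hω).1 i⟩ fun N => (hexp N).1 i,
      SRK.hasBSeries_of_isBigO hf hm h0 rfl
        ⟨min r ε, lt_min hr hε, fun h ω hω => (hsol h ω hω).2⟩ fun N => (hexp N).2⟩
  · intro W hW lam σ t H Y hstep
    have hm : ∀ h, AEMeasurable (SRK.drivingIncrement lam σ W t h) P := fun h =>
      (((hW.aemeasurable (t + h)).sub (hW.aemeasurable t)).const_mul σ).const_add (lam * (h : ℝ))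
    have h0 : ∀ ω, SRK.drivingIncrement lam σ W t 0 ω = 0 := fun ω => by
      simp [SRK.drivingIncrement]
    have hlim : ∀ᵐ ω ∂P,
        Filter.Tendsto (fun h => SRK.drivingIncrement lam σ W t h ω) (𝓝 0) (𝓝 0) := by
      filter_upwards [hW.cont] with ω hω
      have hcont : Continuous fun h => SRK.drivingIncrement lam σ W t h ω := by
        unfold SRK.drivingIncrement
        fun_prop
      simpa [h0] using hcont.tendsto 0
    have hsol : ∀ᵐ ω ∂P, ∀ᶠ h in 𝓝 (0 : ℝ≥0),
        (fun i => H i h ω) = H₀ (SRK.drivingIncrement lam σ W t h ω) ∧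
          Y h ω = y₀ (SRK.drivingIncrement lam σ W t h ω) := by
      -- By path continuity the increment enters, for small `h`, the neighbourhood of zero on which
      -- solutions are unique.
      filter_upwards [hlim, hstep] with ω hω hs
      filter_upwards [hω.eventually huniq, hs] with h hu hs
      exact hu _ _ hs
    exact ⟨fun i => SRK.hasBSeriesAS_of_isBigO hf hm h0 hlim rfl (Z := fun μ => H₀ μ i)
        (hsol.mono fun ω hω => hω.mono fun h hh => congrFun hh.1 i) fun N => (hexp N).1 i,
      SRK.hasBSeriesAS_of_isBigO hf hm h0 hlim rfl
        (hsol.mono fun ω hω => hω.mono fun h hh => hh.2) fun N => (hexp N).2⟩
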